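/- Let $\mathcal{E}=\{p_j,\rho_j\}_{j\in\mathcal{A}}$ be an ensemble of density matrices on a finite-dimensional Hilbert space $\mathcal{H}$ with a finite alphabet $\mathcal{A}$, let $\rho=\sum_j p_j\rho_j$, let $S(\sigma)=-\mathrm{Tr}[\sigma\log_2\sigma]$, and let $\chi=S(\rho)-\sum_j p_jS(\rho_j)$ be the Holevo information. For $\vec{j}\in\mathcal{A}^n$ put $\rho_{\vec{j}}=\rho_{j_1}\otimes\cdots\otimes\rho_{j_n}$. For $\delta>0$ let $P$ be the projector onto the span of the product eigenvectors of $\rho^{\otimes n}$ with positive eigenvalue $q$ satisfying $|-\frac1n\log_2 q-S(\rho)|\le\delta$, and let $P_{\vec{j}}$ be the projector onto the span of the product eigenvectors of $\rho_{\vec{j}}$ with positive eigenvalue $\lambda$ satisfying $|-\frac1n\log_2\lambda-\sum_j p_jS(\rho_j)|\le\delta$. Draw $N=2^{u_F}$ codewords $\vec{j}^{(1)},\dots,\vec{j}^{(N)}\in\mathcal{A}^n$ independently, each with law $p_{\vec{j}}=p_{j_1}\cdots p_{j_n}$; write $\langle\cdot\rangle_{\mathcal{S}}$ for the average over such codes,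 and identify the indices $\ell\in\{1,\dots,N\}$ bijectively (possibly depending on the code) with the bit strings $\vec{k}^{(\ell)}\in\{0,1\}^{u_F}$. For $0\le u\le u_F$ put $$S^{(u)}_{k_1,\dots,k_u}=\sum_{\ell:\ (k^{(\ell)}_1,\dots,k^{(\ell)}_u)=(k_1,\dots,k_u)}P_{\vec{j}^{(\ell)}},$$ and for $1\le u\le u_F$ $$N^{(u)}_{k_1,\dots,k_u}=\big[S^{(u-1)}_{k_1,\dots,k_{u-1}}\big]^{-1/2}\,S^{(u)}_{k_1,\dots,k_u}\,\big[S^{(u-1)}_{k_1,\dots,k_{u-1}}\big]^{-1/2},$$ where the inverse square root is taken on the support and is zero on its orthogonal complement. Let $R$ and $\delta>0$ be real numbers with $R<\chi-2\delta$ (such a $\delta$ exists for every $R<\chi$). Then (a) for every $n$, every code, every labelling, every $1\le u\le u_F$ and all $k_1,\dots,k_{u-1}$, the operators $N^{(u)}_{k_1,\dots,k_{u-1},0}$, $N^{(u)}_{k_1,\dots,k_{u-1},1}$ and $\mathbf{1}-N^{(u)}_{k_1,\dots,k_{u-1},0}-N^{(u)}_{k_1,\dots,k_{u-1},1}$ are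 positive semidefinite, that is, they form a POVM; (b) there is a function $\epsilon(n)>0$ with $n^2\epsilon(n)\to0$ as $n\to\infty$ such that for all $n$, all integers $0\le u_F\le nR$, all labellings, all $\ell\in\{1,\dots,2^{u_F}\}$ and all $u\in\{1,\dots,u_F\}$, $$\Big\langle\mathrm{Tr}\big[N^{(u)}_{k^{(\ell)}_1,\dots,k^{(\ell)}_u}\,P\rho_{\vec{j}^{(\ell)}}P\big]\Big\rangle_{\mathcal{S}}\ \ge\ 1-\epsilon(n).$$ Moreover, if $\mathcal{T}$ is a completely positive trace preserving map between finite-dimensional matrix algebras, the input space being nonzero, and $R<C_{Hol}=\sup\chi(\{p_j,\mathcal{T}(\sigma_j)\})$, the supremum running over all input ensembles $\{p_j,\sigma_j\}$ with a finite alphabet, then some output ensemble $\{p_j,\mathcal{T}(\sigma_j)\}$ of $\mathcal{T}$ with a finite alphabet has $R<\chi$, so that (a) and (b) apply to it. -/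

import Mathlib

open scoped ComplexOrder

noncomputable section

namespace Bisection

/-- A density matrix on the Hilbert space `ℂ^d`: positive semidefinite with unit trace. -/
structure DensityMatrix (d : Type*) [Fintype d] where
  mat : Matrix d d ℂ
  posSemidef : mat.PosSemidef
  trace_eq_one : mat.trace = 1

namespace DensityMatrix

variable {d : Type*} [Fintype d] [DecidableEq d]

/-- The eigenvalues of a density matrix, with multiplicity. -/
def eig (r : DensityMatrix d) (x : d) : ℝ := r.posSemidef.isHermitian.eigenvalues x

/-- An orthonormal eigenbasis: `r.eigvec x` is an eigenvector for `r.eig x`. -/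
def eigvec (r : DensityMatrix d) (x : d) : d → ℂ :=
  fun i => r.posSemidef.isHermitian.eigenvectorBasis x i

/-- Von Neumann entropy in bits, `-Tr[r log₂ r]`, evaluated on the spectrum of `r`
(with `0 log 0 = 0`). -/
def entropy (r : DensityMatrix d) : ℝ := -∑ x, r.eig x * Real.logb 2 (r.eig x)

end DensityMatrix

/-- The product state `r 0 ⊗ ⋯ ⊗ r (n-1)` on `(ℂ^d)^{⊗ n}`, in the product basis. -/
def tensor {d : Type*} [Fintype d] {n : ℕ} (r : Fin n → DensityMatrix d) :
    Matrix (Fin n → d) (Fin n → d) ℂ :=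
  Matrix.of fun a b => ∏ q, (r q).mat (a q) (b q)

/-- An ensemble of quantum states: the letter `j` has probability `prob j` and is represented by
the density matrix `state j`. -/
structure Ensemble (A d : Type*) [Fintype A] [Fintype d] where
  prob : A → ℝ
  prob_nonneg : ∀ j, 0 ≤ prob j
  prob_sum : ∑ j, prob j = 1
  state : A → DensityMatrix d

namespace Ensemble

variable {A d : Type*} [Fintype A] [Fintype d]

/-- The average state `∑ j, p_j ρ_j`. -/
def avg (E : Ensemble A d) : DensityMatrix d where
  mat := ∑ j, (E.prob j : ℂ) • (E.state j).mat
  posSemidef := by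
    refine Matrix.posSemidef_sum _ fun j _ => (E.state j).posSemidef.smul ?_
    exact_mod_cast E.prob_nonneg j
  trace_eq_one := by
    simp only [Matrix.trace_sum, Matrix.trace_smul, DensityMatrix.trace_eq_one, smul_eq_mul,
      mul_one]
    exact_mod_cast E.prob_sum

/-- The average entropy `∑ j, p_j S(ρ_j)`, which is the conditional entropy `H(Y|J)`. -/
def condEntropy [DecidableEq d] (E : Ensemble A d) : ℝ := ∑ j, E.prob j * (E.state j).entropy

/-- The Holevo information `S(∑ j, p_j ρ_j) - ∑ j, p_j S(ρ_j)`. -/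
def holevo [DecidableEq d] (E : Ensemble A d) : ℝ := E.avg.entropy - E.condEntropy

end Ensemble

/-- A quantum channel: a completely positive, trace preserving linear map. Complete positivity says
that for every `k` the map `id_k ⊗ T` preserves positive semidefiniteness. -/
structure Channel (a d : Type*) [Fintype a] [Fintype d] where
  map : Matrix a a ℂ →ₗ[ℂ] Matrix d d ℂ
  completelyPositive : ∀ (k : ℕ) (X : Matrix (Fin k × a) (Fin k × a) ℂ), X.PosSemidef →
    (Matrix.of fun s t : Fin k × d =>
      map (Matrix.of fun i j => X (s.1, i) (t.1, j)) s.2 t.2).PosSemidef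
  tracePreserving : ∀ X, (map X).trace = X.trace

namespace Channel

variable {a d : Type*} [Fintype a] [Fintype d]

/-- The image of a density matrix under a channel. -/
def apply (T : Channel a d) (s : DensityMatrix a) : DensityMatrix d where
  mat := T.map s.mat
  posSemidef :=
    (T.completelyPositive 1 _ (s.posSemidef.submatrix (Prod.snd : Fin 1 × a → a))).submatrix
      (fun i : d => ((0 : Fin 1), i))
  trace_eq_one := by rw [T.tracePreserving, s.trace_eq_one]

/-- The output ensemble `{p_j, T(σ_j)}` of an input ensemble `{p_j, σ_j}`. -/
def output {A : Type*} [Fintype A] (T : Channel a d) (E : Ensemble A a) : Ensemble A d where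
  prob := E.prob
  prob_nonneg := E.prob_nonneg
  prob_sum := E.prob_sum
  state := fun j => T.apply (E.state j)

/-- The Holevo bound `C_Hol`: the supremum of the Holevo information of the output ensemble over
all input ensembles with a finite alphabet. -/
def holevoCapacity [DecidableEq d] (T : Channel a d) : ℝ :=
  sSup {x : ℝ | ∃ (b : ℕ) (E : Ensemble (Fin b) a), x = (T.output E).holevo}

end Channel

section Typical

variable {d : Type*} [Fintype d] [DecidableEq d]

/-- The projector `∑_y |e_y⟩⟨e_y|` onto the span of those product eigenvectors
`e_y = e_{y 0} ⊗ ⋯ ⊗ e_{y (n-1)}` of `r 0 ⊗ ⋯ ⊗ r (n-1)` whose eigenvalue `λ_y` satisfies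
`|-(1/n) log₂ λ_y - h| ≤ δ`. Eigenvectors with `λ_y = 0` have infinite sample entropy, so they
are not typical. -/
def typicalProj {n : ℕ} (r : Fin n → DensityMatrix d) (h δ : ℝ) :
    Matrix (Fin n → d) (Fin n → d) ℂ :=
  open Classical in
  ∑ y : Fin n → d with 0 < ∏ q, (r q).eig (y q) ∧
      |-(1 / (n : ℝ)) * Real.logb 2 (∏ q, (r q).eig (y q)) - h| ≤ δ,
    Matrix.vecMulVec (fun i => ∏ q, (r q).eigvec (y q) (i q))
      (star fun i => ∏ q, (r q).eigvec (y q) (i q))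

variable {A : Type*} [Fintype A]

/-- The projector `P` on the `δ`-typical subspace of `n` copies of the average state. -/
def Ensemble.avgProj (E : Ensemble A d) (δ : ℝ) (n : ℕ) : Matrix (Fin n → d) (Fin n → d) ℂ :=
  typicalProj (fun _ => E.avg) E.avg.entropy δ

/-- The projector `P_j` on the `δ`-conditionally typical subspace of the codeword state
`ρ_{j 0} ⊗ ⋯ ⊗ ρ_{j (n-1)}`. -/
def Ensemble.wordProj (E : Ensemble A d) (δ : ℝ) {n : ℕ} (j : Fin n → A) :
    Matrix (Fin n → d) (Fin n → d) ℂ :=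
  typicalProj (fun q => E.state (j q)) E.condEntropy δ

/-- The state `ρ_j = ρ_{j 0} ⊗ ⋯ ⊗ ρ_{j (n-1)}` of the codeword `j`. -/
def Ensemble.wordState (E : Ensemble A d) {n : ℕ} (j : Fin n → A) :
    Matrix (Fin n → d) (Fin n → d) ℂ :=
  tensor fun q => E.state (j q)

end Typical

/-- A code with `2 ^ m` codewords of length `n` over the alphabet `A` (drawn independently, hence
not necessarily distinct). -/
abbrev Code (A : Type*) (n m : ℕ) := Fin (2 ^ m) → Fin n → A

/-- An identification of the codeword indices with the bit strings of length `m`. -/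
abbrev Labelling (m : ℕ) := Fin (2 ^ m) ≃ (Fin m → Bool)

/-- The average `∑_C P(C) f(C)` over all random codes, `P(C) = ∏_ℓ ∏_q p_{j_q^{(ℓ)}}`. -/
def Ensemble.codeAverage {A d : Type*} [Fintype A] [Fintype d] (E : Ensemble A d) {n m : ℕ}
    (f : Code A n m → ℝ) : ℝ :=
  ∑ C : Code A n m, (∏ ℓ, ∏ q, E.prob (C ℓ q)) * f C

/-- The subset of the codeword indices whose bit string starts with `k`. -/
def subcode {m : ℕ} (e : Labelling m) {u : ℕ} (hu : u ≤ m) (k : Fin u → Bool) :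
    Finset (Fin (2 ^ m)) :=
  Finset.univ.filter fun ℓ => Fin.take u hu (e ℓ) = k

/-- `M^{-1/2}` on the support of a positive semidefinite matrix `M`, and `0` on its kernel
(`(√0)⁻¹ = 0` here), by functional calculus. -/
def invSqrt {ι : Type*} [Fintype ι] [DecidableEq ι] (M : Matrix ι ι ℂ) : Matrix ι ι ℂ :=
  cfc (fun x : ℝ => (Real.sqrt x)⁻¹) M

section PGM

variable {A d : Type*} [Fintype A] [Fintype d] [DecidableEq d]

/-- `S^{(u)}_{k_1, …, k_u}`: the sum of the conditionally typical projectors of the codewords whose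
bit string starts with `k`. -/
def Ensemble.projSum (E : Ensemble A d) (δ : ℝ) {n m : ℕ} (C : Code A n m) (e : Labelling m)
    {u : ℕ} (hu : u ≤ m) (k : Fin u → Bool) : Matrix (Fin n → d) (Fin n → d) ℂ :=
  ∑ ℓ ∈ subcode e hu k, E.wordProj δ (C ℓ)

/-- The measurement operator of step `u + 1`,
`N^{(u+1)}_{k_1, …, k_{u+1}} = S^{-1/2} S^{(u+1)}_{k_1, …, k_{u+1}} S^{-1/2}` with
`S = S^{(u)}_{k_1, …, k_u}`. -/
def Ensemble.pgm (E : Ensemble A d) (δ : ℝ) {n m : ℕ} (C : Code A n m) (e : Labelling m)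
    {u : ℕ} (hu : u + 1 ≤ m) (k : Fin (u + 1) → Bool) : Matrix (Fin n → d) (Fin n → d) ℂ :=
  invSqrt (E.projSum δ C e (Nat.le_of_succ_le hu) (Fin.init k)) *
    E.projSum δ C e hu k *
    invSqrt (E.projSum δ C e (Nat.le_of_succ_le hu) (Fin.init k))

end PGM

end Bisection

end

/-!
A step of the sequential decoder separates one half of the surviving codewords from the other by a
square-root measurement, and it succeeds at rates below the Holevo information for the same reason
as the ordinary square-root measurement does.

That the operators of a step form a measurement holds because the two halves sum up to the operator
`S` of the step, and `S^{-1/2} S S^{-1/2}` is the projector onto the support of `S`.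

For the success probability, the operator of the correct half dominates `S^{-1/2} P_ℓ S^{-1/2}`,
the square-root measurement operator of the sent codeword `ℓ` among the surviving ones. The
Hayashi–Nagaoka inequality `Bisection.one_sub_invSqrt_mul_mul_invSqrt_le` gives
`1 - S^{-1/2} P_ℓ S^{-1/2} ≤ 2 (1 - P_ℓ) + 4 ∑ P_ℓ'`, the sum running over the other surviving
codewords. Enlarging this sum to all other codewords makes the bound independent of the labelling,
which may therefore depend on the code. Three terms remain to be averaged over the codes.

* The projection by `P` before the measurement costs a multiple of `Tr[(1 - P) ρ^{⊗n}]`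
  (`Bisection.mul_mul_le_two_nsmul`), and `P_ℓ` misses `ρ_ℓ` with average probability
  `⟨Tr[(1 - P_j) ρ_j]⟩`. In product eigenbases both are probabilities that a mean of independent
  variables deviates from its expectation, so they decay exponentially (`exists_chernoff`).
* A wrong codeword is independent of the sent one, so that its confusion probability averages to
  `Tr[P_ℓ' P ρ^{⊗n} P]`. Typicality bounds `P ρ^{⊗n} P` by `2^{-n(S(ρ) - δ)}` and the rank of `P_ℓ'`
  by `2^{n(∑ p_j S(ρ_j) + δ)}`, whence the bound `2^{-n(χ - 2δ)}`. There are fewer than `2^{nR}` such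
  codewords.

Exponential decay beats the factor `n^2`.
-/

noncomputable section

/-! ### Operator inequalities -/

section Operator

open scoped MatrixOrder
open Matrix

namespace Matrix

variable {ι : Type*} [Fintype ι] [DecidableEq ι]

theorem re_trace_mul_nonneg {M N : Matrix ι ι ℂ} (hM : 0 ≤ M) (hN : 0 ≤ N) :
    0 ≤ (trace (M * N)).re := by
  have h : trace (M * N) = trace (CFC.sqrt N * M * CFC.sqrt N) := by
    rw [mul_assoc, trace_mul_comm (CFC.sqrt N), mul_assoc, CFC.sqrt_mul_sqrt_self N hN]
  have h0 : 0 ≤ CFC.sqrt N * M * CFC.sqrt N :=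
    (CFC.sqrt_nonneg N).isSelfAdjoint.conjugate_nonneg hM
  rw [h]
  exact (Complex.le_def.1 (nonneg_iff_posSemidef.1 h0).trace_nonneg).1

theorem re_trace_mul_le {M M' N : Matrix ι ι ℂ} (hM : M ≤ M') (hN : 0 ≤ N) :
    (trace (M * N)).re ≤ (trace (M' * N)).re := by
  have := re_trace_mul_nonneg (sub_nonneg.2 hM) hN
  rw [sub_mul, trace_sub, Complex.sub_re] at this
  linarith

/-- Operator monotonicity of the square root, in the only case needed: a projection has itself as
square root. -/
theorem le_cfc_sqrt_of_le {p M : Matrix ι ι ℂ} (hp : IsStarProjection p) (hpM : p ≤ M) :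
    p ≤ cfc Real.sqrt M := by
  open scoped Matrix.Norms.L2Operator in
  have h := CFC.sqrt_le_sqrt p M hpM
  have hM : 0 ≤ M := hp.nonneg.trans hpM
  have hpp : CFC.sqrt p = p := CFC.sqrt_unique hp.isIdempotentElem hp.nonneg
  rw [hpp, CFC.sqrt_eq_real_sqrt M hM, cfcₙ_eq_cfc] at h
  exact h

end Matrix

namespace Bisection

variable {ι : Type*} [Fintype ι] [DecidableEq ι]

theorem isSelfAdjoint_invSqrt (M : Matrix ι ι ℂ) : IsSelfAdjoint (invSqrt M) :=
  cfc_predicate _ _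

/-- Both sides use `(√0)⁻¹ = 0`, so no invertibility of `M` is needed. -/
theorem invSqrt_mul_self {M : Matrix ι ι ℂ} (hM : 0 ≤ M) : invSqrt M * M = cfc Real.sqrt M := by
  have hsa : IsSelfAdjoint M := hM.isSelfAdjoint
  have hc (f : ℝ → ℝ) : ContinuousOn f (spectrum ℝ M) := M.finite_real_spectrum.continuousOn f
  conv_lhs => rw [invSqrt]; arg 2; rw [← cfc_id ℝ M hsa]
  rw [← cfc_mul _ _ M (hc _) (hc _)]
  refine cfc_congr fun x hx => ?_
  have hx0 : 0 ≤ x := spectrum_nonneg_of_nonneg hM hx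
  simp only [id]
  rw [inv_mul_eq_div, Real.div_sqrt]

theorem self_mul_invSqrt {M : Matrix ι ι ℂ} (hM : 0 ≤ M) : M * invSqrt M = cfc Real.sqrt M := by
  have h := congrArg star (invSqrt_mul_self hM)
  have hq : IsSelfAdjoint (cfc Real.sqrt M) := cfc_predicate _ _
  rwa [star_mul, (isSelfAdjoint_invSqrt M).star_eq, hM.isSelfAdjoint.star_eq, hq.star_eq] at h

/-- `M^{-1/2} M M^{-1/2}` is the projection onto the support of `M`, hence at most `1`. -/
theorem invSqrt_mul_self_mul_invSqrt_le_one {M : Matrix ι ι ℂ} (hM : 0 ≤ M) :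
    invSqrt M * M * invSqrt M ≤ 1 := by
  have hc (f : ℝ → ℝ) : ContinuousOn f (spectrum ℝ M) := M.finite_real_spectrum.continuousOn f
  rw [invSqrt_mul_self hM, invSqrt, ← cfc_mul _ _ M (hc _) (hc _)]
  refine cfc_le_one _ _ fun x hx => ?_
  exact mul_inv_le_one

section Identities

variable {R : Type*} [Ring R]

/-- The algebra behind the Hayashi–Nagaoka inequality, with `r = (s + t)^{-1/2}` and
`q = (s + t)^{1/2}` in mind: the last two summands vanish and the other
four are positive semidefinite. -/
theorem hayashi_nagaoka_identity (r s t q : R) : 2 • (1 - s) + 4 • t - (1 - r * s * r) =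
    (r - 1 - 1) * t * (r - 1 - 1) + 2 • ((r - 1) * s * (r - 1)) + (1 - r * (s + t) * r)
      + 4 • (q - s) + 2 • (r * (s + t) - q) + 2 • ((s + t) * r - q) := by
  noncomm_ring

theorem gentle_identity (P Q : R) : 2 • Q + 2 • (1 - P) - P * Q * P =
    (1 + 1 - P) * Q * (1 + 1 - P) + 2 • ((1 - P) * (1 - Q) * (1 - P)) + 2 • (P - P * P) := by
  noncomm_ring

end Identities

/-- The **Hayashi–Nagaoka inequality** for a projection `s`, with the inverse square root taken on
the support of `s + t`. -/
theorem one_sub_invSqrt_mul_mul_invSqrt_le {s t : Matrix ι ι ℂ} (hs : IsStarProjection s)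
    (ht : 0 ≤ t) :
    1 - invSqrt (s + t) * s * invSqrt (s + t) ≤ 2 • (1 - s) + 4 • t := by
  have hM : 0 ≤ s + t := add_nonneg hs.nonneg ht
  have hr : IsSelfAdjoint (invSqrt (s + t)) := isSelfAdjoint_invSqrt _
  have hrM := invSqrt_mul_self hM
  have hMr := self_mul_invSqrt hM
  have hP := invSqrt_mul_self_mul_invSqrt_le_one hM
  have hq := le_cfc_sqrt_of_le hs (le_add_of_nonneg_right ht)
  set r := invSqrt (s + t)
  set q := cfc Real.sqrt (s + t)
  have h1 : 0 ≤ (r - 1) * s * (r - 1) := (hr.sub (.one _)).conjugate_nonneg hs.nonneg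
  have h2 : 0 ≤ (r - 1 - 1) * t * (r - 1 - 1) :=
    ((hr.sub (.one _)).sub (.one _)).conjugate_nonneg ht
  rw [← sub_nonneg, hayashi_nagaoka_identity r s t q, hrM, hMr, sub_self, smul_zero, add_zero, add_zero]
  rw [hrM] at hP
  exact add_nonneg (add_nonneg (add_nonneg h2 (nsmul_nonneg h1 2)) (sub_nonneg.2 hP))
    (nsmul_nonneg (sub_nonneg.2 hq) 4)

/-- The outcome `Q` after a projection by `P` is at most twice as likely as `Q` without it, up to
twice the probability that the projection fails. -/
theorem mul_mul_le_two_nsmul {P Q : Matrix ι ι ℂ} (hP : IsStarProjection P)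
    (hQ : IsStarProjection Q) : P * Q * P ≤ 2 • Q + 2 • (1 - P) := by
  have hP' := hP.isSelfAdjoint
  have h1 : 0 ≤ (1 + 1 - P) * Q * (1 + 1 - P) :=
    (((IsSelfAdjoint.one _).add (.one _)).sub hP').conjugate_nonneg hQ.nonneg
  have h2 : 0 ≤ (1 - P) * (1 - Q) * (1 - P) :=
    ((IsSelfAdjoint.one _).sub hP').conjugate_nonneg hQ.one_sub.nonneg
  rw [← sub_nonneg, gentle_identity P Q, hP.isIdempotentElem.eq, sub_self, smul_zero, add_zero]
  exact add_nonneg h1 (nsmul_nonneg h2 2)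

/-- The probability of decoding correctly with a square-root measurement operator `N` that
dominates the one of the codeword projector `p`, where `t` collects the projectors of the competing
codewords, when the state `ρ` is projected by `P` before the measurement. -/
theorem one_sub_le_re_trace_mul {P p t ρ N : Matrix ι ι ℂ} (hP : IsStarProjection P)
    (hp : IsStarProjection p) (ht : 0 ≤ t) (hρ : 0 ≤ ρ) (hρ1 : ρ.trace = 1)
    (hN : invSqrt (p + t) * p * invSqrt (p + t) ≤ N) :
    1 - (5 * (trace ((1 - P) * ρ)).re + 4 * (trace ((1 - p) * ρ)).re
        + 4 * (trace (t * (P * ρ * P))).re) ≤ (trace (N * (P * ρ * P))).re := by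
  have hPρ : 0 ≤ P * ρ * P := hP.isSelfAdjoint.conjugate_nonneg hρ
  have h1 : 1 - (2 • (1 - p) + 4 • t) ≤ N :=
    (sub_le_comm.1 (one_sub_invSqrt_mul_mul_invSqrt_le hp ht)).trans hN
  have h2 := re_trace_mul_le h1 hPρ
  have h3 := re_trace_mul_le (mul_mul_le_two_nsmul hP hp.one_sub) hρ
  have e1 : trace (P * ρ * P) = trace ρ - trace ((1 - P) * ρ) := by
    rw [trace_mul_comm, ← mul_assoc, hP.isIdempotentElem.eq, sub_mul, one_mul, trace_sub,
      sub_sub_cancel]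
  have e2 : trace (P * (1 - p) * P * ρ) = trace ((1 - p) * (P * ρ * P)) := by
    rw [trace_mul_comm, ← trace_mul_comm (P * ρ * P)]
    simp only [← mul_assoc]
    rw [trace_mul_comm]
    simp only [← mul_assoc]
  have hsmul (k : ℕ) (x : ℂ) : (k • x).re = k * x.re := by simp
  rw [e2, add_mul, trace_add, smul_mul_assoc, smul_mul_assoc, trace_smul, trace_smul,
    Complex.add_re, hsmul, hsmul] at h3
  rw [sub_mul, add_mul, one_mul, trace_sub, trace_add, smul_mul_assoc, smul_mul_assoc, trace_smul,
    trace_smul, Complex.sub_re, Complex.add_re, hsmul, hsmul, e1, hρ1, Complex.sub_re,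
    Complex.one_re] at h2
  push_cast at h2 h3
  linarith

end Bisection

end Operator

/-! ### Sums over independent samples -/

section Sampling

variable {ι X : Type*} [Fintype ι] [Fintype X]

theorem sum_prod_eq_one [DecidableEq ι] {w : X → ℝ} (hw : ∑ x, w x = 1) :
    ∑ C : ι → X, ∏ i, w (C i) = 1 := by
  rw [← Fintype.prod_sum fun (_ : ι) x => w x]
  simp [hw]

theorem sum_prod_mul_eq_sum_split [DecidableEq ι] (w : X → ℝ) (ℓ : ι)
    (F : X → ({i // i ≠ ℓ} → X) → ℝ) :
    ∑ C : ι → X, (∏ i, w (C i)) * F (C ℓ) (fun i => C i) =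
      ∑ x, w x * ∑ C : {i // i ≠ ℓ} → X, (∏ i, w (C i)) * F x C := by
  simp_rw [Finset.mul_sum]
  rw [← Fintype.sum_prod_type', ← (Equiv.funSplitAt ℓ X).sum_comp]
  refine Finset.sum_congr rfl fun C _ => ?_
  rw [Fintype.prod_eq_mul_prod_subtype_ne _ ℓ, mul_assoc]
  rfl

/-- The marginal of an independent sample at one index. -/
theorem sum_prod_mul_apply [DecidableEq ι] {w : X → ℝ} (hw : ∑ x, w x = 1) (ℓ : ι) (f : X → ℝ) :
    ∑ C : ι → X, (∏ i, w (C i)) * f (C ℓ) = ∑ x, w x * f x := by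
  rw [sum_prod_mul_eq_sum_split w ℓ fun x _ => f x]
  simp_rw [← Finset.sum_mul, sum_prod_eq_one hw, one_mul]

/-- The joint marginal of an independent sample at two distinct indices. -/
theorem sum_prod_mul_apply_apply [DecidableEq ι] {w : X → ℝ} (hw : ∑ x, w x = 1) {ℓ ℓ' : ι}
    (h : ℓ' ≠ ℓ) (f : X → X → ℝ) :
    ∑ C : ι → X, (∏ i, w (C i)) * f (C ℓ) (C ℓ') = ∑ x, w x * ∑ y, w y * f x y := by
  rw [sum_prod_mul_eq_sum_split w ℓ fun x C => f x (C ⟨ℓ', h⟩)]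
  simp_rw [sum_prod_mul_apply hw]

end Sampling

section LargeDeviations

variable {X : Type*} [Fintype X]

/-- For a centred variable and `δ > 0` some positive exponential moment of `g - δ` is below `1`. -/
theorem exists_sum_mul_exp_lt_one {w g : X → ℝ} (hw1 : ∑ x, w x = 1)
    (hg : ∑ x, w x * g x = 0) {δ : ℝ} (hδ : 0 < δ) :
    ∃ t : ℝ, 0 < t ∧ ∑ x, w x * Real.exp (t * (g x - δ)) < 1 := by
  have hd : HasDerivAt (fun t : ℝ => ∑ x, w x * Real.exp (t * (g x - δ))) (-δ) 0 := by
    have h (x : X) : HasDerivAt (fun t : ℝ => w x * Real.exp (t * (g x - δ)))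
        (w x * (g x - δ)) 0 := by
      have h1 := (((hasDerivAt_id (0 : ℝ)).mul_const (g x - δ)).exp).const_mul (w x)
      simpa using h1
    have h2 := HasDerivAt.fun_sum fun x (_ : x ∈ Finset.univ) => h x
    have e : ∑ x, w x * (g x - δ) = -δ := by
      simp_rw [mul_sub, Finset.sum_sub_distrib]
      rw [hg, ← Finset.sum_mul, hw1, one_mul, zero_sub]
    rwa [e] at h2
  have hs := hd.tendsto_slope_zero_right
  have hev : ∀ᶠ t in nhdsWithin (0 : ℝ) (Set.Ioi 0), t⁻¹ •
      ((∑ x, w x * Real.exp ((0 + t) * (g x - δ))) - ∑ x, w x * Real.exp (0 * (g x - δ))) < 0 :=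
    hs.eventually_lt_const (neg_neg_of_pos hδ)
  obtain ⟨t, ht, ht0⟩ := (hev.and self_mem_nhdsWithin).exists
  refine ⟨t, ht0, ?_⟩
  simp only [zero_add, zero_mul, Real.exp_zero, mul_one, hw1, smul_eq_mul] at ht
  by_contra! hcon
  exact absurd ht (not_lt.2 (mul_nonneg (inv_nonneg.2 (le_of_lt ht0)) (sub_nonneg.2 hcon)))

/-- One-sided Chernoff bound for a finitely supported law. -/
theorem exists_chernoff_upper {w g : X → ℝ} (hw : ∀ x, 0 ≤ w x) (hw1 : ∑ x, w x = 1)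
    (hg : ∑ x, w x * g x = 0) {δ : ℝ} (hδ : 0 < δ) :
    ∃ θ : ℝ, 0 ≤ θ ∧ θ < 1 ∧ ∀ n : ℕ,
      ∑ y : Fin n → X, (∏ q, w (y q)) * (if n * δ < ∑ q, g (y q) then 1 else 0) ≤ θ ^ n := by
  obtain ⟨t, ht, ht1⟩ := exists_sum_mul_exp_lt_one hw1 hg hδ
  refine ⟨_, Finset.sum_nonneg fun x _ => mul_nonneg (hw x) (Real.exp_pos _).le, ht1, fun n => ?_⟩
  have hpow : (∑ x, w x * Real.exp (t * (g x - δ))) ^ n =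
      ∑ y : Fin n → X, ∏ q, (w (y q) * Real.exp (t * (g (y q) - δ))) := by
    rw [← Fintype.prod_sum fun (_ : Fin n) x => w x * Real.exp (t * (g x - δ))]
    simp
  rw [hpow]
  refine Finset.sum_le_sum fun y _ => ?_
  rw [Finset.prod_mul_distrib, ← Real.exp_sum]
  refine mul_le_mul_of_nonneg_left ?_ (Finset.prod_nonneg fun q _ => hw _)
  split_ifs with h
  · refine Real.one_le_exp ?_
    rw [← Finset.mul_sum, Finset.sum_sub_distrib]
    simp only [Finset.sum_const, Finset.card_univ, Fintype.card_fin, nsmul_eq_mul]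
    exact mul_nonneg ht.le (sub_nonneg.2 h.le)
  · exact (Real.exp_pos _).le

/-- Two-sided Chernoff bound for a finitely supported law. -/
theorem exists_chernoff {w g : X → ℝ} (hw : ∀ x, 0 ≤ w x) (hw1 : ∑ x, w x = 1)
    (hg : ∑ x, w x * g x = 0) {δ : ℝ} (hδ : 0 < δ) :
    ∃ θ : ℝ, 0 ≤ θ ∧ θ < 1 ∧ ∀ n : ℕ,
      ∑ y : Fin n → X, (∏ q, w (y q)) * (if n * δ < |∑ q, g (y q)| then 1 else 0) ≤
        2 * θ ^ n := by
  obtain ⟨θ₁, h0₁, h1₁, h₁⟩ := exists_chernoff_upper hw hw1 hg hδ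
  obtain ⟨θ₂, h0₂, h1₂, h₂⟩ := exists_chernoff_upper (g := fun x => -g x) hw hw1
    (by simp [hg]) hδ
  refine ⟨max θ₁ θ₂, h0₁.trans (le_max_left _ _), max_lt h1₁ h1₂, fun n => ?_⟩
  have hle : ∑ y : Fin n → X, (∏ q, w (y q)) * (if n * δ < |∑ q, g (y q)| then 1 else 0) ≤
      ∑ y : Fin n → X, ((∏ q, w (y q)) * (if n * δ < ∑ q, g (y q) then 1 else 0) +
        (∏ q, w (y q)) * (if n * δ < ∑ q, -g (y q) then 1 else 0)) := by
    refine Finset.sum_le_sum fun y _ => ?_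
    rw [← mul_add]
    refine mul_le_mul_of_nonneg_left ?_ (Finset.prod_nonneg fun q _ => hw _)
    rw [Finset.sum_neg_distrib]
    simp only [lt_abs]
    split_ifs <;> first | tauto | norm_num
  rw [Finset.sum_add_distrib] at hle
  have e₁ := pow_le_pow_left₀ h0₁ (le_max_left θ₁ θ₂) n
  have e₂ := pow_le_pow_left₀ h0₂ (le_max_right θ₁ θ₂) n
  linarith [h₁ n, h₂ n]

end LargeDeviations

/-! ### Product eigenbases and typical projectors -/

section Typical

open scoped MatrixOrder
open Matrix

namespace Bisection

variable {d : Type*} {n : ℕ}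

/-- The tensor product of the matrices `M 0, …, M (n-1)` in the product basis. -/
def piKron (M : Fin n → Matrix d d ℂ) : Matrix (Fin n → d) (Fin n → d) ℂ :=
  of fun a b => ∏ q, M q (a q) (b q)

theorem piKron_mul [Fintype d] (M N : Fin n → Matrix d d ℂ) :
    piKron M * piKron N = piKron fun q => M q * N q := by
  ext a b
  simp only [piKron, mul_apply, of_apply, ← Finset.prod_mul_distrib]
  exact (Fintype.prod_sum fun q x => M q (a q) x * N q x (b q)).symm

theorem conjTranspose_piKron (M : Fin n → Matrix d d ℂ) :
    (piKron M)ᴴ = piKron fun q => (M q)ᴴ := by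
  ext a b
  simp [piKron, conjTranspose_apply]

theorem piKron_diagonal [DecidableEq d] (v : Fin n → d → ℂ) :
    piKron (fun q => diagonal (v q)) = diagonal fun y => ∏ q, v q (y q) := by
  ext a b
  by_cases h : a = b
  · subst h; simp [piKron]
  · obtain ⟨q, hq⟩ := Function.ne_iff.1 h
    rw [diagonal_apply_ne _ h]
    exact Finset.prod_eq_zero (Finset.mem_univ q) (diagonal_apply_ne _ hq)

theorem piKron_one [DecidableEq d] : piKron (fun _ : Fin n => (1 : Matrix d d ℂ)) = 1 := by
  simp_rw [← diagonal_one, piKron_diagonal, Finset.prod_const_one]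

theorem trace_tensor [Fintype d] (r : Fin n → DensityMatrix d) : trace (tensor r) = 1 := by
  have h : trace (tensor r) = ∏ q, trace (r q).mat := by
    simp only [trace, diag, tensor, of_apply]
    exact (Fintype.prod_sum fun q x => (r q).mat x x).symm
  rw [h]
  simp [DensityMatrix.trace_eq_one]

variable [Fintype d] [DecidableEq d]

namespace DensityMatrix

/-- The unitary whose columns are the eigenvectors of `r`. -/
def eigU (r : DensityMatrix d) : Matrix d d ℂ := of fun i x => r.eigvec x i

theorem eigU_eq (r : DensityMatrix d) :
    r.eigU = (r.posSemidef.isHermitian.eigenvectorUnitary : Matrix d d ℂ) := by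
  ext i x
  exact (r.posSemidef.isHermitian.eigenvectorUnitary_apply i x).symm

theorem conjTranspose_eigU_mul (r : DensityMatrix d) : r.eigUᴴ * r.eigU = 1 := by
  rw [eigU_eq]
  exact Unitary.coe_star_mul_self _

theorem eigU_mul_conjTranspose (r : DensityMatrix d) : r.eigU * r.eigUᴴ = 1 := by
  rw [eigU_eq]
  exact Unitary.coe_mul_star_self _

theorem mat_eq (r : DensityMatrix d) :
    r.mat = r.eigU * diagonal (fun x => (r.eig x : ℂ)) * r.eigUᴴ := by
  rw [eigU_eq]
  have h := r.posSemidef.isHermitian.spectral_theorem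
  rw [Unitary.conjStarAlgAut_apply] at h
  exact h

theorem eig_nonneg (r : DensityMatrix d) (x : d) : 0 ≤ r.eig x :=
  r.posSemidef.eigenvalues_nonneg x

theorem sum_eig (r : DensityMatrix d) : ∑ x, r.eig x = 1 := by
  have h := r.posSemidef.isHermitian.trace_eq_sum_eigenvalues
  rw [r.trace_eq_one] at h
  have h' : ((∑ x, r.eig x : ℝ) : ℂ) = 1 := by
    rw [Complex.ofReal_sum]
    exact h.symm
  exact_mod_cast h'

/-- The mean of the sample entropy is the von Neumann entropy. -/
theorem sum_eig_mul_neg_logb_sub (r : DensityMatrix d) (h : ℝ) :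
    ∑ x, r.eig x * (-Real.logb 2 (r.eig x) - h) = r.entropy - h := by
  simp_rw [mul_sub, Finset.sum_sub_distrib]
  rw [← Finset.sum_mul, r.sum_eig, one_mul, entropy]
  simp

end DensityMatrix

/-- The unitary whose columns are the product eigenvectors of `r 0 ⊗ ⋯ ⊗ r (n-1)`. -/
def prodU (r : Fin n → DensityMatrix d) : Matrix (Fin n → d) (Fin n → d) ℂ :=
  piKron fun q => (r q).eigU

/-- The eigenvalue of `r 0 ⊗ ⋯ ⊗ r (n-1)` at the product eigenvector labelled by `y`. -/
def prodEig (r : Fin n → DensityMatrix d) (y : Fin n → d) : ℝ := ∏ q, (r q).eig (y q)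

variable (r : Fin n → DensityMatrix d)

theorem prodEig_nonneg (y : Fin n → d) : 0 ≤ prodEig r y :=
  Finset.prod_nonneg fun q _ => (r q).eig_nonneg (y q)

theorem sum_prodEig : ∑ y, prodEig r y = 1 := by
  simp only [prodEig]
  rw [← Fintype.prod_sum fun q x => (r q).eig x]
  simp [DensityMatrix.sum_eig]

theorem conjTranspose_prodU_mul : (prodU r)ᴴ * prodU r = 1 := by
  simp_rw [prodU, conjTranspose_piKron, piKron_mul, DensityMatrix.conjTranspose_eigU_mul,
    piKron_one]

theorem prodU_mul_conjTranspose : prodU r * (prodU r)ᴴ = 1 := by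
  simp_rw [prodU, conjTranspose_piKron, piKron_mul, DensityMatrix.eigU_mul_conjTranspose,
    piKron_one]

/-- The matrix that is diagonal in the product eigenbasis of `r`, with entries `f`. -/
def eigDiag (f : (Fin n → d) → ℝ) : Matrix (Fin n → d) (Fin n → d) ℂ :=
  prodU r * diagonal (fun y => (f y : ℂ)) * (prodU r)ᴴ

theorem eigDiag_mul (f g : (Fin n → d) → ℝ) :
    eigDiag r f * eigDiag r g = eigDiag r fun y => f y * g y := by
  have h : eigDiag r f * eigDiag r g = prodU r * (diagonal (fun y => (f y : ℂ)) *
      ((prodU r)ᴴ * prodU r) * diagonal (fun y => (g y : ℂ))) * (prodU r)ᴴ := by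
    simp only [eigDiag, Matrix.mul_assoc]
  rw [h, conjTranspose_prodU_mul, Matrix.mul_one, diagonal_mul_diagonal]
  simp [eigDiag]

theorem eigDiag_sub (f g : (Fin n → d) → ℝ) :
    eigDiag r f - eigDiag r g = eigDiag r fun y => f y - g y := by
  simp only [eigDiag, ← Matrix.sub_mul, ← Matrix.mul_sub, diagonal_sub, Complex.ofReal_sub]

theorem eigDiag_const (c : ℝ) : eigDiag r (fun _ => c) = (c : ℂ) • 1 := by
  have h : diagonal (fun _ : Fin n → d => (c : ℂ)) = (c : ℂ) • 1 := by
    rw [smul_one_eq_diagonal]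
  rw [eigDiag, h, Matrix.mul_smul, Matrix.smul_mul, Matrix.mul_one, prodU_mul_conjTranspose]

theorem eigDiag_one : eigDiag r (fun _ => 1) = 1 := by
  rw [eigDiag_const, Complex.ofReal_one, one_smul]

theorem re_trace_eigDiag (f : (Fin n → d) → ℝ) : (trace (eigDiag r f)).re = ∑ y, f y := by
  rw [eigDiag, trace_mul_comm, ← Matrix.mul_assoc, conjTranspose_prodU_mul, Matrix.one_mul,
    trace_diagonal]
  simp

theorem eigDiag_nonneg {f : (Fin n → d) → ℝ} (hf : ∀ y, 0 ≤ f y) : 0 ≤ eigDiag r f := by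
  refine nonneg_iff_posSemidef.2 (PosSemidef.mul_mul_conjTranspose_same ?_ _)
  refine PosSemidef.diagonal fun y => ?_
  simpa using hf y

theorem eigDiag_le {f g : (Fin n → d) → ℝ} (h : ∀ y, f y ≤ g y) : eigDiag r f ≤ eigDiag r g := by
  rw [← sub_nonneg, eigDiag_sub]
  exact eigDiag_nonneg r fun y => sub_nonneg.2 (h y)

theorem tensor_eq_eigDiag : tensor r = eigDiag r (prodEig r) := by
  have h : tensor r = piKron fun q => (r q).mat := rfl
  rw [h]
  simp_rw [DensityMatrix.mat_eq, ← piKron_mul, ← conjTranspose_piKron, piKron_diagonal]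
  simp [eigDiag, prodU, prodEig]

theorem tensor_nonneg : 0 ≤ tensor r := by
  rw [tensor_eq_eigDiag]
  exact eigDiag_nonneg r (prodEig_nonneg r)

/-- The labels of the `δ`-typical product eigenvectors, for the sample entropy `h`. -/
def IsTypical (h δ : ℝ) (y : Fin n → d) : Prop :=
  0 < prodEig r y ∧ |-(1 / (n : ℝ)) * Real.logb 2 (prodEig r y) - h| ≤ δ

open Classical in
theorem typicalProj_eq_eigDiag (h δ : ℝ) :
    typicalProj r h δ = eigDiag r fun y => if IsTypical r h δ y then 1 else 0 := by
  ext a b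
  rw [typicalProj, Matrix.sum_apply, Finset.sum_filter, eigDiag, Matrix.mul_apply]
  refine Finset.sum_congr rfl fun y _ => ?_
  rw [mul_diagonal, conjTranspose_apply]
  by_cases hy : IsTypical r h δ y
  · refine (if_pos hy).trans ?_
    rw [if_pos hy]
    simp [vecMulVec_apply, prodU, piKron, DensityMatrix.eigU]
  · refine (if_neg hy).trans ?_
    rw [if_neg hy]
    simp

theorem isStarProjection_typicalProj (h δ : ℝ) : IsStarProjection (typicalProj r h δ) := by
  rw [typicalProj_eq_eigDiag]
  refine ⟨?_, (eigDiag_nonneg r fun y => by split_ifs <;> norm_num).isSelfAdjoint⟩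
  rw [IsIdempotentElem, eigDiag_mul]
  congr 1
  ext y
  split_ifs <;> simp

open Classical in
theorem re_trace_one_sub_typicalProj_mul (h δ : ℝ) :
    (trace ((1 - typicalProj r h δ) * tensor r)).re =
      ∑ y, prodEig r y * if IsTypical r h δ y then 0 else 1 := by
  rw [typicalProj_eq_eigDiag, tensor_eq_eigDiag, ← eigDiag_one r, eigDiag_sub, eigDiag_mul,
    re_trace_eigDiag]
  refine Finset.sum_congr rfl fun y _ => ?_
  split_ifs <;> simp

variable {r}

theorem IsTypical.bounds {h δ : ℝ} {y : Fin n → d} (hn : 0 < n) (hy : IsTypical r h δ y) :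
    (2 : ℝ) ^ (-(n * (h + δ))) ≤ prodEig r y ∧ prodEig r y ≤ (2 : ℝ) ^ (-(n * (h - δ))) := by
  obtain ⟨h0, h1⟩ := hy
  have hn' : (0 : ℝ) < n := Nat.cast_pos.2 hn
  rw [abs_le, neg_mul, one_div, inv_mul_eq_div] at h1
  obtain ⟨h2, h3⟩ := h1
  have e : (n : ℝ) * (Real.logb 2 (prodEig r y) / n) = Real.logb 2 (prodEig r y) :=
    mul_div_cancel₀ _ hn'.ne'
  rw [← Real.le_logb_iff_rpow_le one_lt_two h0, ← Real.logb_le_iff_le_rpow one_lt_two h0, ← e]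
  constructor <;> nlinarith

variable (r)

/-- The rank of the typical projector is at most `2 ^ (n (h + δ))`, as the typical eigenvalues are
at least `2 ^ (-n (h + δ))` and sum up to at most `1`. -/
theorem re_trace_typicalProj_le (hn : 0 < n) (h δ : ℝ) :
    (trace (typicalProj r h δ)).re ≤ (2 : ℝ) ^ (n * (h + δ)) := by
  classical
  rw [typicalProj_eq_eigDiag, re_trace_eigDiag]
  calc ∑ y, (if IsTypical r h δ y then (1 : ℝ) else 0)
      ≤ ∑ y, (2 : ℝ) ^ (n * (h + δ)) * prodEig r y := by
        refine Finset.sum_le_sum fun y _ => ?_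
        split_ifs with hy
        · have := mul_le_mul_of_nonneg_left (hy.bounds hn).1
            (Real.rpow_nonneg zero_le_two ((n : ℝ) * (h + δ)))
          rwa [← Real.rpow_add two_pos, add_neg_cancel, Real.rpow_zero] at this
        · exact mul_nonneg (Real.rpow_nonneg zero_le_two _) (prodEig_nonneg r y)
    _ = _ := by rw [← Finset.mul_sum, sum_prodEig, mul_one]

theorem typicalProj_mul_tensor_mul_le (hn : 0 < n) (h δ : ℝ) :
    typicalProj r h δ * tensor r * typicalProj r h δ ≤
      (((2 : ℝ) ^ (-(n * (h - δ))) : ℝ) : ℂ) • 1 := by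
  classical
  rw [typicalProj_eq_eigDiag, tensor_eq_eigDiag, eigDiag_mul, eigDiag_mul, ← eigDiag_const r]
  refine eigDiag_le r fun y => ?_
  by_cases hy : IsTypical r h δ y
  · simpa [hy] using (hy.bounds hn).2
  · simpa [hy] using Real.rpow_nonneg zero_le_two _

/-- An atypical product eigenvector has a sample entropy away from `h`, unless its eigenvalue
vanishes. -/
theorem prodEig_mul_not_isTypical_le (h δ : ℝ) (hn : 0 < n) (y : Fin n → d) :
    (open Classical in prodEig r y * if IsTypical r h δ y then 0 else 1) ≤
      prodEig r y * if n * δ < |∑ q, (-Real.logb 2 ((r q).eig (y q)) - h)| then 1 else 0 := by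
  classical
  rcases (prodEig_nonneg r y).eq_or_lt with h0 | h0
  · simp [← h0]
  refine mul_le_mul_of_nonneg_left ?_ h0.le
  by_cases hy : IsTypical r h δ y
  · rw [if_pos hy]
    split_ifs <;> norm_num
  rw [if_neg hy, if_pos]
  have hn' : (0 : ℝ) < n := Nat.cast_pos.2 hn
  have hlt : δ < |-(1 / (n : ℝ)) * Real.logb 2 (prodEig r y) - h| := by
    by_contra! hcon
    exact hy ⟨h0, hcon⟩
  have hlog : Real.logb 2 (prodEig r y) = ∑ q, Real.logb 2 ((r q).eig (y q)) :=
    Real.logb_prod _ _ fun q _ hq => h0.ne' (Finset.prod_eq_zero (Finset.mem_univ q) hq)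
  have e : ∑ q, (-Real.logb 2 ((r q).eig (y q)) - h) =
      n * (-(1 / (n : ℝ)) * Real.logb 2 (prodEig r y) - h) := by
    rw [hlog, Finset.sum_sub_distrib, Finset.sum_neg_distrib, Finset.sum_const, Finset.card_univ,
      Fintype.card_fin, nsmul_eq_mul]
    field_simp
  rw [e, abs_mul, abs_of_pos hn']
  exact mul_lt_mul_of_pos_left hlt hn'

end Bisection

end Typical

/-! ### Random codes and the sequential measurement -/

section Coding

open scoped MatrixOrder
open Matrix

namespace Bisection

variable {A d : Type*} [Fintype A] [Fintype d]

namespace Ensemble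

/-- The probability of a word of independent letters. -/
def wordProb (E : Ensemble A d) {n : ℕ} (j : Fin n → A) : ℝ := ∏ q, E.prob (j q)

theorem wordProb_nonneg (E : Ensemble A d) {n : ℕ} (j : Fin n → A) : 0 ≤ E.wordProb j :=
  Finset.prod_nonneg fun _ _ => E.prob_nonneg _

theorem sum_wordProb (E : Ensemble A d) (n : ℕ) : ∑ j : Fin n → A, E.wordProb j = 1 :=
  sum_prod_eq_one E.prob_sum

theorem sum_wordProb_smul_wordState (E : Ensemble A d) (n : ℕ) :
    ∑ j : Fin n → A, (E.wordProb j : ℂ) • E.wordState j = tensor fun _ => E.avg := by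
  ext a b
  simp only [Matrix.sum_apply, Matrix.smul_apply, wordState, tensor, of_apply, wordProb, avg, smul_eq_mul,
    Complex.ofReal_prod, ← Finset.prod_mul_distrib]
  exact (Fintype.prod_sum fun q j => (E.prob j : ℂ) * (E.state j).mat (a q) (b q)).symm

/-- Averaged over the words, the codeword state is `n` copies of the average state. -/
theorem sum_wordProb_mul_re_trace (E : Ensemble A d) {n : ℕ}
    (M : Matrix (Fin n → d) (Fin n → d) ℂ) :
    ∑ j : Fin n → A, E.wordProb j * (trace (M * E.wordState j)).re =
      (trace (M * tensor fun _ => E.avg)).re := by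
  rw [← E.sum_wordProb_smul_wordState, Matrix.mul_sum, trace_sum, Complex.re_sum]
  refine Finset.sum_congr rfl fun j _ => ?_
  rw [Matrix.mul_smul, trace_smul, smul_eq_mul, Complex.re_ofReal_mul]

theorem codeAverage_apply (E : Ensemble A d) {n m : ℕ} (ℓ : Fin (2 ^ m)) (f : (Fin n → A) → ℝ) :
    (E.codeAverage fun C : Code A n m => f (C ℓ)) = ∑ j, E.wordProb j * f j :=
  sum_prod_mul_apply (E.sum_wordProb n) ℓ f

theorem codeAverage_apply_apply (E : Ensemble A d) {n m : ℕ} {ℓ ℓ' : Fin (2 ^ m)} (h : ℓ' ≠ ℓ)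
    (f : (Fin n → A) → (Fin n → A) → ℝ) :
    (E.codeAverage fun C : Code A n m => f (C ℓ) (C ℓ')) =
      ∑ j, E.wordProb j * ∑ j', E.wordProb j' * f j j' :=
  sum_prod_mul_apply_apply (E.sum_wordProb n) h f

theorem codeAverage_mono (E : Ensemble A d) {n m : ℕ} {f g : Code A n m → ℝ} (h : ∀ C, f C ≤ g C) :
    E.codeAverage f ≤ E.codeAverage g :=
  Finset.sum_le_sum fun C _ => mul_le_mul_of_nonneg_left (h C)
    (Finset.prod_nonneg fun _ _ => E.wordProb_nonneg _)

theorem codeAverage_add (E : Ensemble A d) {n m : ℕ} (f g : Code A n m → ℝ) :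
    (E.codeAverage fun C => f C + g C) = E.codeAverage f + E.codeAverage g := by
  simp only [codeAverage, mul_add, Finset.sum_add_distrib]

theorem codeAverage_const_mul (E : Ensemble A d) {n m : ℕ} (c : ℝ) (f : Code A n m → ℝ) :
    (E.codeAverage fun C => c * f C) = c * E.codeAverage f := by
  simp only [codeAverage, Finset.mul_sum, mul_left_comm]

theorem codeAverage_sum (E : Ensemble A d) {n m : ℕ} {κ : Type*} (s : Finset κ)
    (f : κ → Code A n m → ℝ) :
    (E.codeAverage fun C => ∑ i ∈ s, f i C) = ∑ i ∈ s, E.codeAverage (f i) := by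
  simp only [codeAverage, Finset.mul_sum]
  exact Finset.sum_comm

theorem codeAverage_one (E : Ensemble A d) (n m : ℕ) :
    (E.codeAverage fun _ : Code A n m => 1) = 1 := by
  simp only [codeAverage, mul_one]
  exact sum_prod_eq_one (E.sum_wordProb n)

variable [DecidableEq d]

theorem isStarProjection_wordProj (E : Ensemble A d) (δ : ℝ) {n : ℕ} (j : Fin n → A) :
    IsStarProjection (E.wordProj δ j) :=
  isStarProjection_typicalProj _ _ _

/-- `n` copies of the average state lie in the typical subspace up to an exponentially small
error. -/
theorem exists_avgProj_tail (E : Ensemble A d) {δ : ℝ} (hδ : 0 < δ) :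
    ∃ θ : ℝ, 0 ≤ θ ∧ θ < 1 ∧ ∀ n : ℕ, 0 < n →
      (trace ((1 - E.avgProj δ n) * tensor fun _ => E.avg)).re ≤ 2 * θ ^ n := by
  classical
  obtain ⟨θ, h0, h1, h⟩ := exists_chernoff (w := E.avg.eig)
    (g := fun x => -Real.logb 2 (E.avg.eig x) - E.avg.entropy) E.avg.eig_nonneg E.avg.sum_eig
    (by rw [E.avg.sum_eig_mul_neg_logb_sub, sub_self]) hδ
  refine ⟨θ, h0, h1, fun n hn => le_trans (le_of_eq_of_le ?_ (Finset.sum_le_sum fun y _ =>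
    prodEig_mul_not_isTypical_le (fun _ => E.avg) E.avg.entropy δ hn y)) (h n)⟩
  exact re_trace_one_sub_typicalProj_mul _ _ _

/-- On average the codeword state lies in its conditionally typical subspace up to an exponentially
small error: the pairs of a letter and an eigenvector label are independent with law
`p_j λ_{j, x}`, under which `-log₂ λ_{j, x}` has mean `∑ j, p_j S(ρ_j)`. -/
theorem exists_wordProj_tail (E : Ensemble A d) {δ : ℝ} (hδ : 0 < δ) :
    ∃ θ : ℝ, 0 ≤ θ ∧ θ < 1 ∧ ∀ n : ℕ, 0 < n →
      ∑ j : Fin n → A, E.wordProb j * (trace ((1 - E.wordProj δ j) * E.wordState j)).re ≤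
        2 * θ ^ n := by
  classical
  obtain ⟨θ, h0, h1, h⟩ := exists_chernoff
    (w := fun z : A × d => E.prob z.1 * (E.state z.1).eig z.2)
    (g := fun z => -Real.logb 2 ((E.state z.1).eig z.2) - E.condEntropy)
    (fun z => mul_nonneg (E.prob_nonneg _) ((E.state z.1).eig_nonneg _))
    (by simp [Fintype.sum_prod_type, ← Finset.mul_sum, DensityMatrix.sum_eig, E.prob_sum])
    (by
      have hj (j : A) : ∑ x, E.prob j * (E.state j).eig x *
          (-Real.logb 2 ((E.state j).eig x) - E.condEntropy) =
          E.prob j * (E.state j).entropy - E.prob j * E.condEntropy := by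
        simp_rw [mul_assoc, ← Finset.mul_sum, DensityMatrix.sum_eig_mul_neg_logb_sub, mul_sub]
      rw [Fintype.sum_prod_type]
      simp only [hj]
      rw [Finset.sum_sub_distrib, ← Finset.sum_mul, E.prob_sum, one_mul, condEntropy, sub_self]) hδ
  refine ⟨θ, h0, h1, fun n hn => le_trans ?_ (h n)⟩
  rw [← (Equiv.arrowProdEquivProdArrow (Fin n) (fun _ => A) (fun _ => d)).symm.sum_comp,
    Fintype.sum_prod_type]
  refine Finset.sum_le_sum fun j _ => ?_
  rw [wordProj, wordState, re_trace_one_sub_typicalProj_mul, Finset.mul_sum]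
  refine Finset.sum_le_sum fun y _ => ?_
  refine (mul_le_mul_of_nonneg_left (prodEig_mul_not_isTypical_le (fun q => E.state (j q))
    E.condEntropy δ hn y) (E.wordProb_nonneg j)).trans_eq ?_
  simp only [wordProb, prodEig, Finset.prod_mul_distrib, mul_assoc]
  rfl

/-- The probability of mistaking a codeword for an independent one: the projected average state is
at most `2 ^ (-n (S(ρ) - δ))`, and the conditionally typical subspace has dimension at most
`2 ^ (n (∑ j, p_j S(ρ_j) + δ))`. -/
theorem re_trace_wordProj_mul_le (E : Ensemble A d) (δ : ℝ) {n : ℕ} (hn : 0 < n) (j : Fin n → A) :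
    (trace (E.wordProj δ j * (E.avgProj δ n * (tensor fun _ => E.avg) * E.avgProj δ n))).re ≤
      (2 : ℝ) ^ (-(n * (E.holevo - 2 * δ))) := by
  have h1 := re_trace_mul_le
    (typicalProj_mul_tensor_mul_le (fun _ : Fin n => E.avg) hn E.avg.entropy δ)
    (E.isStarProjection_wordProj δ j).nonneg
  have h2 := re_trace_typicalProj_le (fun q => E.state (j q)) hn E.condEntropy δ
  rw [trace_mul_comm]
  refine h1.trans ?_
  rw [smul_mul_assoc, one_mul, trace_smul, smul_eq_mul, Complex.re_ofReal_mul]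
  refine (mul_le_mul_of_nonneg_left h2 (Real.rpow_nonneg zero_le_two _)).trans_eq ?_
  rw [← Real.rpow_add two_pos, holevo]
  congr 1
  ring

theorem sum_wordProb_mul_re_trace_wordProj_le (E : Ensemble A d) (δ : ℝ) {n : ℕ} (hn : 0 < n) :
    ∑ j : Fin n → A, E.wordProb j * ∑ j' : Fin n → A, E.wordProb j' * (trace (E.wordProj δ j' *
      (E.avgProj δ n * E.wordState j * E.avgProj δ n))).re ≤
      (2 : ℝ) ^ (-(n * (E.holevo - 2 * δ))) := by
  have hcyc (X ρ P : Matrix (Fin n → d) (Fin n → d) ℂ) :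
      trace (X * (P * ρ * P)) = trace (P * X * P * ρ) := by
    rw [← mul_assoc, trace_mul_comm]
    simp only [mul_assoc]
  simp_rw [Finset.mul_sum]
  rw [Finset.sum_comm]
  have hj' (j' : Fin n → A) : ∑ j : Fin n → A, E.wordProb j * (E.wordProb j' *
      (trace (E.wordProj δ j' * (E.avgProj δ n * E.wordState j * E.avgProj δ n))).re) ≤
      E.wordProb j' * (2 : ℝ) ^ (-(n * (E.holevo - 2 * δ))) := by
    simp_rw [mul_left_comm (E.wordProb _) (E.wordProb j'), ← Finset.mul_sum, hcyc]
    rw [E.sum_wordProb_mul_re_trace, ← hcyc]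
    exact mul_le_mul_of_nonneg_left (E.re_trace_wordProj_mul_le δ hn j') (E.wordProb_nonneg j')
  refine (Finset.sum_le_sum fun j' _ => hj' j').trans_eq ?_
  rw [← Finset.sum_mul, E.sum_wordProb, one_mul]

variable {n m : ℕ} (E : Ensemble A d) (δ : ℝ) (C : Code A n m) (e : Labelling m)

theorem projSum_nonneg {u : ℕ} (hu : u ≤ m) (k : Fin u → Bool) : 0 ≤ E.projSum δ C e hu k :=
  Finset.sum_nonneg fun _ _ => (E.isStarProjection_wordProj δ _).nonneg

theorem pgm_nonneg {u : ℕ} (hu : u + 1 ≤ m) (k : Fin (u + 1) → Bool) : 0 ≤ E.pgm δ C e hu k :=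
  (isSelfAdjoint_invSqrt _).conjugate_nonneg (E.projSum_nonneg δ C e hu k)

theorem projSum_snoc_add {u : ℕ} (hu : u + 1 ≤ m) (k : Fin u → Bool) :
    E.projSum δ C e hu (Fin.snoc k false) + E.projSum δ C e hu (Fin.snoc k true) =
      E.projSum δ C e (Nat.le_of_succ_le hu) k := by
  have hs (b : Bool) : subcode e hu (Fin.snoc k b) =
      (subcode e (Nat.le_of_succ_le hu) k).filter fun ℓ => e ℓ ⟨u, hu⟩ = b := by
    ext ℓ
    simp only [subcode, Finset.mem_filter, Finset.mem_univ, true_and]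
    rw [Fin.take_succ_eq_snoc, Fin.snoc_inj]
  have hnot : (subcode e hu (Fin.snoc k false)) =
      (subcode e (Nat.le_of_succ_le hu) k).filter fun ℓ => ¬ e ℓ ⟨u, hu⟩ = true := by
    rw [hs]
    exact Finset.filter_congr fun ℓ _ => (Bool.not_eq_true _).symm.to_iff
  rw [add_comm, projSum, projSum, hs true, hnot, Finset.sum_filter_add_sum_filter_not, projSum]

theorem pgm_snoc_add_le_one {u : ℕ} (hu : u + 1 ≤ m) (k : Fin u → Bool) :
    E.pgm δ C e hu (Fin.snoc k false) + E.pgm δ C e hu (Fin.snoc k true) ≤ 1 := by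
  simp only [pgm, Fin.init_snoc]
  rw [← add_mul, ← mul_add, projSum_snoc_add]
  exact invSqrt_mul_self_mul_invSqrt_le_one (E.projSum_nonneg δ C e _ k)

/-- The success probability of one step for a fixed code. Whatever the labelling, the step competes
only with some of the other codewords, so all of them may be counted as competitors. -/
theorem one_sub_le_re_trace_pgm_mul (ℓ : Fin (2 ^ m)) {u : ℕ} (hu : u + 1 ≤ m) :
    1 - (5 * (trace ((1 - E.avgProj δ n) * E.wordState (C ℓ))).re
        + 4 * (trace ((1 - E.wordProj δ (C ℓ)) * E.wordState (C ℓ))).re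
        + 4 * ∑ ℓ' ∈ Finset.univ.erase ℓ, (trace (E.wordProj δ (C ℓ') *
            (E.avgProj δ n * E.wordState (C ℓ) * E.avgProj δ n))).re) ≤
      (trace (E.pgm δ C e hu (Fin.take (u + 1) hu (e ℓ)) *
        (E.avgProj δ n * E.wordState (C ℓ) * E.avgProj δ n))).re := by
  have hP : IsStarProjection (E.avgProj δ n) := isStarProjection_typicalProj _ _ _
  have hp := E.isStarProjection_wordProj δ (C ℓ)
  have hρ : 0 ≤ E.wordState (C ℓ) := tensor_nonneg _
  have hnn (s : Finset (Fin (2 ^ m))) : 0 ≤ ∑ ℓ' ∈ s, E.wordProj δ (C ℓ') :=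
    Finset.sum_nonneg fun _ _ => (E.isStarProjection_wordProj δ _).nonneg
  set B := subcode e (Nat.le_of_succ_le hu) (Fin.init (Fin.take (u + 1) hu (e ℓ)))
  have hB : ℓ ∈ B := Finset.mem_filter.2 ⟨Finset.mem_univ _, rfl⟩
  have hℓ : ℓ ∈ subcode e hu (Fin.take (u + 1) hu (e ℓ)) :=
    Finset.mem_filter.2 ⟨Finset.mem_univ _, rfl⟩
  have hS : E.projSum δ C e (Nat.le_of_succ_le hu) (Fin.init (Fin.take (u + 1) hu (e ℓ))) =
      E.wordProj δ (C ℓ) + ∑ ℓ' ∈ B.erase ℓ, E.wordProj δ (C ℓ') :=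
    (Finset.add_sum_erase B (fun ℓ' => E.wordProj δ (C ℓ')) hB).symm
  have hle : E.wordProj δ (C ℓ) ≤ E.projSum δ C e hu (Fin.take (u + 1) hu (e ℓ)) := by
    rw [projSum, ← Finset.add_sum_erase _ _ hℓ]
    exact le_add_of_nonneg_right (hnn _)
  have hN : invSqrt (E.wordProj δ (C ℓ) + ∑ ℓ' ∈ B.erase ℓ, E.wordProj δ (C ℓ')) *
      E.wordProj δ (C ℓ) *
      invSqrt (E.wordProj δ (C ℓ) + ∑ ℓ' ∈ B.erase ℓ, E.wordProj δ (C ℓ')) ≤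
      E.pgm δ C e hu (Fin.take (u + 1) hu (e ℓ)) := by
    rw [pgm, hS]
    exact (isSelfAdjoint_invSqrt _).conjugate_le_conjugate hle
  have h := one_sub_le_re_trace_mul hP hp (hnn _) hρ (trace_tensor _) hN
  have ht := re_trace_mul_le (Finset.sum_le_sum_of_subset_of_nonneg
    (Finset.erase_subset_erase ℓ (Finset.subset_univ B))
    fun ℓ' _ _ => (E.isStarProjection_wordProj δ (C ℓ')).nonneg)
    (hP.isSelfAdjoint.conjugate_nonneg hρ)
  rw [Matrix.sum_mul (Finset.univ.erase ℓ), trace_sum, Complex.re_sum] at ht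
  linarith

/-- The average success probability of one step, in terms of the two typicality errors and the
number `2 ^ m` of possible confusions. -/
theorem one_sub_le_codeAverage (hn : 0 < n) {α β : ℝ}
    (hα : (trace ((1 - E.avgProj δ n) * tensor fun _ => E.avg)).re ≤ α)
    (hβ : ∑ j : Fin n → A, E.wordProb j *
      (trace ((1 - E.wordProj δ j) * E.wordState j)).re ≤ β)
    (e : Code A n m → Labelling m) (ℓ : Fin (2 ^ m)) {u : ℕ} (hu : u + 1 ≤ m) :
    1 - (5 * α + 4 * β + 4 * (2 ^ m * (2 : ℝ) ^ (-(n * (E.holevo - 2 * δ))))) ≤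
      E.codeAverage fun C : Code A n m =>
        (trace (E.pgm δ C (e C) hu (Fin.take (u + 1) hu (e C ℓ)) *
          (E.avgProj δ n * E.wordState (C ℓ) * E.avgProj δ n))).re := by
  have h := E.codeAverage_mono fun C => E.one_sub_le_re_trace_pgm_mul δ C (e C) ℓ hu
  refine le_trans ?_ h
  simp only [sub_eq_add_neg (1 : ℝ), ← neg_one_mul (_ + _ : ℝ)]
  rw [codeAverage_add, codeAverage_one, codeAverage_const_mul, codeAverage_add, codeAverage_add,
    codeAverage_const_mul, codeAverage_const_mul, codeAverage_const_mul, codeAverage_sum]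
  have ha : (E.codeAverage fun C : Code A n m =>
      (trace ((1 - E.avgProj δ n) * E.wordState (C ℓ))).re) ≤ α := by
    refine (E.codeAverage_apply ℓ fun j =>
      (trace ((1 - E.avgProj δ n) * E.wordState j)).re).trans_le ?_
    rwa [E.sum_wordProb_mul_re_trace]
  have hb : (E.codeAverage fun C : Code A n m =>
      (trace ((1 - E.wordProj δ (C ℓ)) * E.wordState (C ℓ))).re) ≤ β :=
    (E.codeAverage_apply ℓ fun j =>
      (trace ((1 - E.wordProj δ j) * E.wordState j)).re).trans_le hβ
  have hc : ∑ ℓ' ∈ Finset.univ.erase ℓ, (E.codeAverage fun C : Code A n m =>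
      (trace (E.wordProj δ (C ℓ') * (E.avgProj δ n * E.wordState (C ℓ) * E.avgProj δ n))).re) ≤
      2 ^ m * (2 : ℝ) ^ (-(n * (E.holevo - 2 * δ))) := by
    have h0 : 0 ≤ (2 : ℝ) ^ (-(n * (E.holevo - 2 * δ))) := Real.rpow_nonneg zero_le_two _
    have hcard : (Finset.univ.erase ℓ).card ≤ 2 ^ m :=
      (Finset.card_erase_le).trans_eq (by simp)
    refine (Finset.sum_le_card_nsmul _ _ ((2 : ℝ) ^ (-(n * (E.holevo - 2 * δ))))
      fun ℓ' hℓ' => ?_).trans ?_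
    · refine (E.codeAverage_apply_apply (Finset.ne_of_mem_erase hℓ') fun j j' => (trace
        (E.wordProj δ j' * (E.avgProj δ n * E.wordState j * E.avgProj δ n))).re).trans_le ?_
      exact E.sum_wordProb_mul_re_trace_wordProj_le δ hn
    · rw [nsmul_eq_mul]
      exact mul_le_mul_of_nonneg_right (by exact_mod_cast hcard) h0
  linarith

end Ensemble

end Bisection

end Coding

/-! ### Rates below the Holevo information -/

namespace Bisection

/-- At rates below `χ - 2δ` the failure probability of a step decays exponentially in the block
length, with one base `θ < 1` for both typicality errors and for the confusions; `22` is twice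
`5 + 4`, from the two-sided tails, plus `4`. -/
theorem Ensemble.exists_error_bound {A d : Type*} [Fintype A] [Fintype d] [DecidableEq d]
    (E : Ensemble A d) {R δ : ℝ} (hδ : 0 < δ) (hR : R < E.holevo - 2 * δ) :
    ∃ θ : ℝ, 0 < θ ∧ θ < 1 ∧ ∀ n m : ℕ, (m : ℝ) ≤ n * R →
      ∀ (e : Code A n m → Labelling m) (ℓ : Fin (2 ^ m)) (u : ℕ) (hu : u + 1 ≤ m),
        1 - 22 * θ ^ n ≤ E.codeAverage fun C : Code A n m =>
          (Matrix.trace (E.pgm δ C (e C) hu (Fin.take (u + 1) hu (e C ℓ)) *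
            (E.avgProj δ n * E.wordState (C ℓ) * E.avgProj δ n))).re := by
  obtain ⟨θ₁, h0₁, h1₁, h₁⟩ := E.exists_avgProj_tail hδ
  obtain ⟨θ₂, h0₂, h1₂, h₂⟩ := E.exists_wordProj_tail hδ
  set θ₃ : ℝ := (2 : ℝ) ^ (R - (E.holevo - 2 * δ)) with hθ₃
  have h0₃ : 0 < θ₃ := Real.rpow_pos_of_pos two_pos _
  have h1₃ : θ₃ < 1 := Real.rpow_lt_one_of_one_lt_of_neg one_lt_two (sub_neg.2 hR)
  refine ⟨max (max θ₁ θ₂) θ₃, lt_max_of_lt_right h0₃, max_lt (max_lt h1₁ h1₂) h1₃,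
    fun n m hm e ℓ u hu => ?_⟩
  -- An empty block leaves no step, since `m = 0` there.
  have hn : 0 < n := by
    rcases Nat.eq_zero_or_pos n with rfl | hn
    · rw [Nat.cast_zero, zero_mul] at hm
      have : m ≤ 0 := by exact_mod_cast hm
      omega
    · exact hn
  refine le_trans ?_ (E.one_sub_le_codeAverage δ hn (h₁ n hn) (h₂ n hn) e ℓ hu)
  have e₁ : θ₁ ^ n ≤ max (max θ₁ θ₂) θ₃ ^ n :=
    pow_le_pow_left₀ h0₁ ((le_max_left _ _).trans (le_max_left _ _)) n
  have e₂ : θ₂ ^ n ≤ max (max θ₁ θ₂) θ₃ ^ n :=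
    pow_le_pow_left₀ h0₂ ((le_max_right _ _).trans (le_max_left _ _)) n
  have e₃ : θ₃ ^ n ≤ max (max θ₁ θ₂) θ₃ ^ n := pow_le_pow_left₀ h0₃.le (le_max_right _ _) n
  have hc : 2 ^ m * (2 : ℝ) ^ (-(n * (E.holevo - 2 * δ))) ≤ θ₃ ^ n := by
    rw [hθ₃, ← Real.rpow_natCast 2 m, ← Real.rpow_add two_pos, ← Real.rpow_mul_natCast zero_le_two]
    refine Real.rpow_le_rpow_of_exponent_le one_le_two ?_
    linarith
  linarith

/-- A single-letter ensemble with a pure state. -/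
theorem Ensemble.nonempty_fin_one (a : Type*) [Fintype a] [Nonempty a] :
    Nonempty (Ensemble (Fin 1) a) := by
  classical
  obtain ⟨x⟩ := ‹Nonempty a›
  exact ⟨{ prob := fun _ => 1
           prob_nonneg := fun _ => zero_le_one
           prob_sum := by simp
           state := fun _ =>
            { mat := Matrix.diagonal (Pi.single x 1)
              posSemidef := Matrix.PosSemidef.diagonal (Pi.single_nonneg.2 zero_le_one)
              trace_eq_one := by simp [Matrix.trace_diagonal] } }⟩

end Bisection

end

theorem lemma7 {a d : Type*} [Fintype a] [Nonempty a] [Fintype d] [DecidableEq d]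
    (T : Bisection.Channel a d) (R : ℝ) :
    (R < T.holevoCapacity →
      ∃ (b : ℕ) (I : Bisection.Ensemble (Fin b) a), R < (T.output I).holevo) ∧
    ∀ (A : Type*) [Fintype A] (E : Bisection.Ensemble A d) (δ : ℝ),
      0 < δ → R < E.holevo - 2 * δ →
        -- the operators of every step form a measurement with outcomes `0`, `1` and null
        (∀ (n m : ℕ) (C : Bisection.Code A n m) (e : Bisection.Labelling m)
            (u : ℕ) (hu : u + 1 ≤ m) (k : Fin u → Bool),
          (E.pgm δ C e hu (Fin.snoc k false)).PosSemidef ∧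
          (E.pgm δ C e hu (Fin.snoc k true)).PosSemidef ∧
          (1 - E.pgm δ C e hu (Fin.snoc k false) - E.pgm δ C e hu (Fin.snoc k true)).PosSemidef) ∧
        -- the sufficient condition
        ∃ ε : ℕ → ℝ, (∀ n, 0 < ε n) ∧
          Filter.Tendsto (fun n : ℕ => (n : ℝ) ^ 2 * ε n) Filter.atTop (nhds 0) ∧
          ∀ n m : ℕ, (m : ℝ) ≤ n * R →
            ∀ (e : Bisection.Code A n m → Bisection.Labelling m)
              (ℓ : Fin (2 ^ m)) (u : ℕ) (hu : u + 1 ≤ m),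
              1 - ε n ≤ E.codeAverage fun C : Bisection.Code A n m =>
                (Matrix.trace
                  (E.pgm δ C (e C) hu (Fin.take (u + 1) hu (e C ℓ)) *
                    (E.avgProj δ n * E.wordState (C ℓ) * E.avgProj δ n))).re := by
  refine ⟨fun hR => ?_, fun A _ E δ hδ hR => ⟨fun n m C e u hu k => ?_, ?_⟩⟩
  · -- Nonemptiness is enough here: were the set unbounded, with junk supremum `0`, then some element
    -- would still exceed `R`.
    obtain ⟨I⟩ := Bisection.Ensemble.nonempty_fin_one a
    rw [Bisection.Channel.holevoCapacity] at hR
    obtain ⟨x, ⟨b, I, rfl⟩, hx⟩ := exists_lt_of_lt_csSup (by exact ⟨_, 1, I, rfl⟩) hR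
    exact ⟨b, I, hx⟩
  · refine ⟨Matrix.nonneg_iff_posSemidef.1 (E.pgm_nonneg δ C e hu _),
      Matrix.nonneg_iff_posSemidef.1 (E.pgm_nonneg δ C e hu _), ?_⟩
    rw [sub_sub]
    exact Matrix.le_iff.1 (E.pgm_snoc_add_le_one δ C e hu k)
  · obtain ⟨θ, h0, h1, h⟩ := E.exists_error_bound hδ hR
    refine ⟨fun n => 22 * θ ^ n, fun n => by positivity, ?_, h⟩
    have ht := (tendsto_pow_const_mul_const_pow_of_abs_lt_one 2
      (abs_lt.2 ⟨by linarith, h1⟩)).const_mul 22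
    simpa [mul_left_comm] using ht
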